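/- Let $d\ge 1$, let $\mathbf X=(X_1,\dots,X_d)$ be a random vector with distribution function $F$ whose margins are continuous and identically distributed, and let $\mathcal D=\{I_1,\dots,I_s\}$ be a partition of $D=\{1,\dots,d\}$ into non-empty blocks. Let $G$ be a multivariate extreme value distribution (max-stable with non-degenerate margins) with unit Fréchet margins $G_i(t)=e^{-1/t}$, $t>0$, and suppose that $F$ belongs to the domain of attraction of $G$, i.e. there are $a_n\in(0,\infty)^d$ and $b_n\in\mathbb R^d$ with $F(a_n\mathbf x+b_n)^n\to G(\mathbf x)$ for all $\mathbf x\in\mathbb R^d$ (operations componentwise). For $I\subseteq D$ let $F_I$, $G_I$ be the distribution functions of the sub-vectors with indices in $I$, and $F_i$, $G_i$ those of the margins. Let $\epsilon_D^G=-\log G(1,\dots,1)$, let $N_x$ be the number of blocks $I_j$ such that $X_i>x$ for at least one $i\in I_j$, and let $FI(\mathbf X,\mathcal D)=\lim_{x\to\infty}E(N_x\mid N_x>0)$. Then $\epsilon_D^G>0$, the limit $FI(\mathbf X,\mathcal D)$ exists, and: (i) $\dfrac{s}{\epsilon_D^G}\le FI(\mathbf X,\mathcal D)\le \dfrac{d}{\epsilon_D^G}$.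 (ii) $FI(\mathbf X,\mathcal D)=d/\epsilon_D^G$ if and only if the components within each block are independent in the sense of the limit law $G$, i.e. for $\mathbf Y\sim G$ and each $j$ the variables $Y_i$, $i\in I_j$, are independent. In particular, this equality holds whenever, for each $j$, the variables $X_i$, $i\in I_j$, are themselves independent. (iii) $FI(\mathbf X,\mathcal D)=s/\epsilon_D^G$ if and only if the components within each block are totally dependent in the sense of the limit law $G$, i.e. $G_{I_j}(\mathbf x)=\min_{i\in I_j}G_i(x_i)$ for all $\mathbf x$ and each $j$. In particular, this equality holds whenever $F_{I_j}(\mathbf x)=\min_{i\in I_j}F_i(x_i)$ for all $\mathbf x$ and each $j$. -/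

import Mathlib

open Filter Topology MeasureTheory ProbabilityTheory

noncomputable section

namespace Fragility

variable {d : ℕ}

/-- The (multivariate) distribution function of a law `μ` on `ℝ^d`, at a point all of whose
coordinates may be infinite: `F(x) = μ {y | y ≤ x componentwise}`. -/
def df (μ : Measure (Fin d → ℝ)) (x : Fin d → EReal) : ℝ :=
  μ.real {y | ∀ i, (y i : EReal) ≤ x i}

/-- The distribution function `F_i` of the `i`-th margin of `μ`. -/
def marginDf (μ : Measure (Fin d → ℝ)) (i : Fin d) (t : ℝ) : ℝ :=
  cdf (μ.map (fun y => y i)) t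

/-- The distribution function `F_I` of the sub-vector with indices in `I`, evaluated at the
sub-vector of `x` (the coordinates outside `I` are sent to `∞`). -/
def blockDf (μ : Measure (Fin d → ℝ)) (I : Finset (Fin d)) (x : Fin d → ℝ) : ℝ :=
  df μ (fun i => if i ∈ I then (x i : EReal) else ⊤)

/-- `G` is a multivariate extreme value distribution: its margins are non-degenerate and it is
max-stable, i.e. for each `n ≥ 1` the componentwise maximum of `n` independent copies has the law
`G` up to an affine normalization of each coordinate. -/
structure IsMEV (G : Measure (Fin d → ℝ)) : Prop where
  nondegenerate : ∀ (i : Fin d) (c : ℝ), G.map (fun y => y i) ≠ Measure.dirac c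
  maxStable : ∀ n : ℕ, 1 ≤ n → ∃ a b : Fin d → ℝ, (∀ i, 0 < a i) ∧
    ∀ x : Fin d → ℝ,
      df G (fun i => ((a i * x i + b i : ℝ) : EReal)) ^ n = df G (fun i => (x i : EReal))

/-- All margins of `G` are unit Fréchet: `G_i(t) = exp(-1/t)` for `t > 0`, and `0` for `t ≤ 0`. -/
def HasUnitFrechetMargins (G : Measure (Fin d → ℝ)) : Prop :=
  ∀ (i : Fin d) (t : ℝ), marginDf G i t = if 0 < t then Real.exp (-1 / t) else 0

/-- The law `μ`, with distribution function `F`, belongs to the (max-)domain of attraction of `G`: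
there are `a_n > 0` and `b_n` in `ℝ^d` with `F(a_n x + b_n)^n → G(x)`. (Extreme value distribution
functions are continuous, so convergence is required at every `x`.) -/
def InDomainOfAttraction (μ G : Measure (Fin d → ℝ)) : Prop :=
  ∃ a b : ℕ → Fin d → ℝ, (∀ n i, 0 < a n i) ∧
    ∀ x : Fin d → ℝ,
      Tendsto (fun n : ℕ => df μ (fun i => ((a n i * x i + b n i : ℝ) : EReal)) ^ n) atTop
        (𝓝 (df G (fun i => (x i : EReal))))

/-- The extremal coefficient `ε_A^G = -log G(1_A^{-1}(1), …, 1_A^{-1}(d))`, where the `i`-th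
argument is `1` for `i ∈ A` and `∞` for `i ∉ A`. -/
def extremalCoeff (G : Measure (Fin d → ℝ)) (A : Finset (Fin d)) : ℝ :=
  -Real.log (df G (fun i => if i ∈ A then (1 : EReal) else ⊤))

open Classical in
/-- `N_x`: the number of blocks of the partition `𝒟` in which at least one component of `X`
exceeds the level `t`. -/
def numExceed {Ω : Type*} (X : Ω → Fin d → ℝ)
    (𝒟 : Finpartition (Finset.univ : Finset (Fin d))) (t : ℝ) (ω : Ω) : ℕ :=
  ∑ I ∈ 𝒟.parts, if ∀ i ∈ I, X ω i ≤ t then 0 else 1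

/-- `E(N_x | N_x > 0)`, the mean of `N_x` under the conditional probability given `N_x > 0`. -/
def condMeanExceed {Ω : Type*} [MeasurableSpace Ω] (P : Measure Ω) (X : Ω → Fin d → ℝ)
    (𝒟 : Finpartition (Finset.univ : Finset (Fin d))) (t : ℝ) : ℝ :=
  ∫ ω, (numExceed X 𝒟 t ω : ℝ) ∂(ProbabilityTheory.cond P {ω | 0 < numExceed X 𝒟 t ω})

/-- The fragility index of `X` relative to `𝒟` exists and equals `c`. -/
def HasFragilityIndex {Ω : Type*} [MeasurableSpace Ω] (P : Measure Ω) (X : Ω → Fin d → ℝ)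
    (𝒟 : Finpartition (Finset.univ : Finset (Fin d))) (c : ℝ) : Prop :=
  Tendsto (condMeanExceed P X 𝒟) atTop (𝓝 c)

/-- Under `μ`, the coordinates within each block of `𝒟` are independent. -/
def IndepWithinBlocks (μ : Measure (Fin d → ℝ))
    (𝒟 : Finpartition (Finset.univ : Finset (Fin d))) : Prop :=
  ∀ I ∈ 𝒟.parts, iIndepFun (fun (i : I) (y : Fin d → ℝ) => y i) μ

/-- Under `μ`, the coordinates within each block of `𝒟` are totally dependent: the distribution
function of the block is the minimum of its margins (blocks are non-empty and finite, so this
infimum is a minimum). -/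
def TotallyDependentWithinBlocks (μ : Measure (Fin d → ℝ))
    (𝒟 : Finpartition (Finset.univ : Finset (Fin d))) : Prop :=
  ∀ I ∈ 𝒟.parts, ∀ x : Fin d → ℝ, blockDf μ I x = ⨅ i : I, marginDf μ i (x i)

end Fragility

end

/-!
The attraction hypothesis is used through the rescaled tails: writing `F_A`, `G_A` for the
distribution functions of sub-vectors, `F_A(a_n x + b_n) ^ n → G_A(x)` amounts to
`n (1 - F_A(a_n x + b_n)) → V_A(x)` with the exponent function `V_A = -log G_A`
(`tendsto_blockDf_pow`, `IsNormalizing.tendsto_mul_tail`). Max-stability with unit Fréchet margins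
makes `V_A` homogeneous of order `-1` (`IsMEV.exponent_natCast_mul`, `IsMEV.exponent_const`).

The mean of `N_t` given `N_t > 0` is the sum over the blocks `I` of `P(X_i > t for some i ∈ I)`,
divided by `P(X_i > t for some i)` (`condMeanExceed_eq`). The margins of `X` share one tail `T`,
which never vanishes, as it is attracted to the Fréchet law (`tail_pos_of_tendsto_mul`). Hence a high
level `t` can be compared with the normalizing levels for the sample size `n = ⌊1 / T t⌋`, and
`n P(X_i > t for some i ∈ A)` tends to the extremal coefficient `ε_A = V_A(1, …, 1)`
(`IsNormalizing.tendsto_floor_mul_tail_diagonal`). So the fragility index is `(∑_I ε_I) / ε_D`, and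
everything reduces to the bounds `1 ≤ ε_I ≤ |I|` and their cases of equality.

* `ε_I = |I|` means that `D_I(x) = ∑_{i ∈ I} 1 / x_i - V_I(x)` vanishes at `(1, …, 1)`. As a limit of
  rescaled means of `(K - 1)⁺`, with `K` the number of exceedances, `D_I` is nonnegative, antitone
  in `x` and monotone in `I`, so it vanishes for all `x ≥ 1` and all sub-blocks, and by homogeneity
  for all `x > 0` (`IsNormalizing.exponent_eq_sum`). Thus `G` factorizes on the block.
* `ε_I = 1` gives `V_I(c, …, c) = 1 / c`, the value for a single margin, and monotonicity yields
  `G_I(x) ≥ G_I(c, …, c) = min_i G_i(x_i)` with `c = min_i x_i`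
  (`IsNormalizing.extremalCoeff_eq_one_iff`).
-/

namespace Fragility

variable {d : ℕ}

/-! ### Distribution functions of sub-vectors -/

lemma blockDf_eq (μ : Measure (Fin d → ℝ)) (I : Finset (Fin d)) (x : Fin d → ℝ) :
    blockDf μ I x = μ.real {y | ∀ i ∈ I, y i ≤ x i} := by
  unfold blockDf df
  congr 1
  ext y
  refine forall_congr' fun i => ?_
  by_cases h : i ∈ I <;> simp [h]

lemma df_coe_eq_blockDf (μ : Measure (Fin d → ℝ)) (x : Fin d → ℝ) :
    df μ (fun i => (x i : EReal)) = blockDf μ Finset.univ x := by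
  simp [blockDf]

lemma extremalCoeff_eq (G : Measure (Fin d → ℝ)) (A : Finset (Fin d)) :
    extremalCoeff G A = -Real.log (blockDf G A fun _ => 1) := by
  simp [extremalCoeff, blockDf]

lemma measurableSet_forall_mem_le (I : Finset (Fin d)) (x : Fin d → ℝ) :
    MeasurableSet {y : Fin d → ℝ | ∀ i ∈ I, y i ≤ x i} := by
  have : {y : Fin d → ℝ | ∀ i ∈ I, y i ≤ x i} = ⋂ i ∈ I, {y | y i ≤ x i} := by ext; simp
  rw [this]
  exact Finset.measurableSet_biInter _ fun i _ =>
    measurableSet_le (measurable_pi_apply i) measurable_const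

lemma marginDf_eq_blockDf (μ : Measure (Fin d → ℝ)) [IsProbabilityMeasure μ] (i : Fin d)
    (x : Fin d → ℝ) : marginDf μ i (x i) = blockDf μ {i} x := by
  have hm : Measurable fun y : Fin d → ℝ => y i := measurable_pi_apply i
  have := Measure.isProbabilityMeasure_map (μ := μ) hm.aemeasurable
  rw [marginDf, cdf_eq_real, map_measureReal_apply hm measurableSet_Iic, blockDf_eq]
  simp [Set.preimage]

lemma blockDf_nonneg (μ : Measure (Fin d → ℝ)) (I : Finset (Fin d)) (x : Fin d → ℝ) :
    0 ≤ blockDf μ I x := measureReal_nonneg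

lemma blockDf_mono (μ : Measure (Fin d → ℝ)) [IsProbabilityMeasure μ] {I J : Finset (Fin d)}
    {x y : Fin d → ℝ} (hJI : J ⊆ I) (hxy : ∀ i ∈ J, x i ≤ y i) :
    blockDf μ I x ≤ blockDf μ J y := by
  rw [blockDf_eq, blockDf_eq]
  exact measureReal_mono fun z hz i hi => (hz i (hJI hi)).trans (hxy i hi)

/-- The distribution function of a sub-vector is recovered from the full distribution function by
letting the remaining arguments tend to infinity. -/
lemma tendsto_blockDf_univ (μ : Measure (Fin d → ℝ)) [IsProbabilityMeasure μ]
    (A : Finset (Fin d)) (x : Fin d → ℝ) (w : ℕ → Fin d → ℝ)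
    (hw : ∀ i ∉ A, Tendsto (fun k => w k i) atTop atTop) :
    Tendsto (fun k => blockDf μ Finset.univ fun i => if i ∈ A then x i else w k i) atTop
      (𝓝 (blockDf μ A x)) := by
  simp only [blockDf_eq]
  refine (ENNReal.tendsto_toReal (measure_ne_top _ _)).comp ?_
  refine tendsto_measure_of_tendsto_indicator_of_isFiniteMeasure _ _
    (fun k => measurableSet_forall_mem_le _ _) fun y => ?_
  have h : ∀ᶠ k in atTop, ∀ i, i ∉ A → y i ≤ w k i := by
    rw [eventually_all]
    intro i
    by_cases hi : i ∈ A
    · simp [hi]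
    · filter_upwards [(hw i hi).eventually_ge_atTop (y i)] with k hk _ using hk
  filter_upwards [h] with k hk
  simp only [Finset.mem_univ, true_imp_iff]
  refine forall_congr' fun i => ?_
  by_cases hi : i ∈ A <;> simp [hi, hk]

/-! ### Convergence of the normalized margins -/

/-- The powers `a ^ n` and `b ^ n` differ by at most `1 - c ^ n`: for events `B ⊆ A` and `B ⊆ C`
with `A \ B ⊆ Cᶜ`, it compares `n` independent repetitions. -/
lemma pow_sub_pow_le_one_sub_pow {a b c : ℝ} (hb : 0 ≤ b) (hba : b ≤ a) (ha : a ≤ 1)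
    (hbc : b ≤ c) (hc : c ≤ 1) (h : a - b ≤ 1 - c) (n : ℕ) : a ^ n - b ^ n ≤ 1 - c ^ n := by
  induction n with
  | zero => simp
  | succ n ih =>
    have h1 : a ^ n ≤ 1 := pow_le_one₀ (hb.trans hba) ha
    have h2 : c ^ n ≤ 1 := pow_le_one₀ (hb.trans hbc) hc
    have h3 : a ^ n * (a - b) ≤ 1 * (1 - c) :=
      mul_le_mul h1 h (sub_nonneg.2 hba) zero_le_one
    have h4 : b * (a ^ n - b ^ n) ≤ b * (1 - c ^ n) := mul_le_mul_of_nonneg_left ih hb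
    have h5 : b * (1 - c ^ n) ≤ c * (1 - c ^ n) :=
      mul_le_mul_of_nonneg_right hbc (sub_nonneg.2 h2)
    rw [pow_succ, pow_succ, pow_succ]
    linarith

lemma blockDf_pow_le (μ : Measure (Fin d → ℝ)) [IsProbabilityMeasure μ] (A : Finset (Fin d))
    (x v : Fin d → ℝ) (n : ℕ) :
    blockDf μ A x ^ n ≤ blockDf μ Finset.univ (fun i => if i ∈ A then x i else v i) ^ n
      + (1 - blockDf μ Finset.univ v ^ n) := by
  set E : Set (Fin d → ℝ) := {y | ∀ i ∈ A, y i ≤ x i} with hE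
  set C : Set (Fin d → ℝ) := {y | ∀ i ∈ Finset.univ, y i ≤ v i} with hC
  have hEm : MeasurableSet E := measurableSet_forall_mem_le _ _
  have hCm : MeasurableSet C := measurableSet_forall_mem_le _ _
  have h1 : μ.real (E ∩ C) ≤ blockDf μ Finset.univ (fun i => if i ∈ A then x i else v i) := by
    rw [blockDf_eq]
    refine measureReal_mono fun y hy i _ => ?_
    by_cases hi : i ∈ A
    · simpa [hi] using hy.1 i hi
    · simpa [hi] using hy.2 i (Finset.mem_univ i)
  have h2 : μ.real E - μ.real (E ∩ C) ≤ 1 - μ.real C := by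
    have h3 := measureReal_union_add_inter (μ := μ) (s := E) hCm
    have h4 : μ.real (E ∪ C) ≤ 1 := measureReal_le_one
    linarith
  have h3 := pow_sub_pow_le_one_sub_pow measureReal_nonneg
    (measureReal_mono Set.inter_subset_left) measureReal_le_one
    (measureReal_mono Set.inter_subset_right) measureReal_le_one h2 n
  have h4 := pow_le_pow_left₀ measureReal_nonneg h1 n
  rw [blockDf_eq μ A, blockDf_eq μ _ v]
  linarith

/-- Attraction of the full vector implies attraction of every sub-vector. The sub-vector is
approximated by large finite arguments in the remaining coordinates; the error is controlled
uniformly in `n` since the normalized maxima are tight. -/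
lemma tendsto_blockDf_pow {μ G : Measure (Fin d → ℝ)} [IsProbabilityMeasure μ]
    [IsProbabilityMeasure G] {a b : ℕ → Fin d → ℝ}
    (h : ∀ x : Fin d → ℝ, Tendsto (fun n : ℕ =>
      df μ (fun i => ((a n i * x i + b n i : ℝ) : EReal)) ^ n) atTop
        (𝓝 (df G (fun i => (x i : EReal)))))
    (A : Finset (Fin d)) (x : Fin d → ℝ) :
    Tendsto (fun n : ℕ => blockDf μ A (fun i => a n i * x i + b n i) ^ n) atTop
      (𝓝 (blockDf G A x)) := by
  have h' : ∀ x : Fin d → ℝ, Tendsto (fun n : ℕ =>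
      blockDf μ Finset.univ (fun i => a n i * x i + b n i) ^ n) atTop
        (𝓝 (blockDf G Finset.univ x)) := by
    intro x
    rw [← df_coe_eq_blockDf]
    refine (h x).congr fun n => ?_
    rw [← df_coe_eq_blockDf]
  have hg := tendsto_blockDf_univ G A x (fun k _ => k) fun _ _ => tendsto_natCast_atTop_atTop
  have hk := tendsto_blockDf_univ G ∅ x (fun k _ => k) fun _ _ => tendsto_natCast_atTop_atTop
  have h0 : blockDf G ∅ x = 1 := by simp [blockDf_eq]
  rw [h0] at hk
  simp only [Finset.notMem_empty, if_false] at hk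
  refine tendsto_order.2 ⟨fun l hl => ?_, fun r hr => ?_⟩
  · obtain ⟨k, hk⟩ := (hg.eventually_const_lt hl).exists
    filter_upwards [(h' _).eventually_const_lt hk] with n hn
    refine hn.trans_le (pow_le_pow_left₀ (blockDf_nonneg _ _ _) ?_ _)
    refine blockDf_mono μ (Finset.subset_univ _) fun i hi => ?_
    simp [hi]
  · have h1 := hg.add (hk.const_sub 1)
    rw [sub_self, add_zero] at h1
    obtain ⟨k, hk⟩ := (h1.eventually_lt_const hr).exists
    filter_upwards [((h' _).add ((h' fun _ => (k : ℝ)).const_sub 1)).eventually_lt_const hk]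
      with n hn
    refine lt_of_le_of_lt ?_ hn
    refine (blockDf_pow_le μ A _ (fun i => a n i * k + b n i) n).trans_eq ?_
    congr 3
    ext i
    split_ifs <;> rfl

/-- If `p n ^ n → g > 0` with `p n ≥ 0`, then `n (1 - p n) → -log g`. -/
lemma tendsto_mul_one_sub_of_tendsto_pow {p : ℕ → ℝ} {g : ℝ} (hp0 : ∀ n, 0 ≤ p n)
    (hg : 0 < g) (h : Tendsto (fun n => p n ^ n) atTop (𝓝 g)) :
    Tendsto (fun n : ℕ => (n : ℝ) * (1 - p n)) atTop (𝓝 (-Real.log g)) := by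
  have hpos : ∀ᶠ n in atTop, 0 < p n := by
    filter_upwards [h.eventually_const_lt hg, eventually_ge_atTop 1] with n hn hn1
    refine (hp0 n).lt_of_ne fun h0 => ?_
    rw [← h0, zero_pow (by omega)] at hn
    exact lt_irrefl _ hn
  have hlog : Tendsto (fun n : ℕ => (n : ℝ) * -Real.log (p n)) atTop (𝓝 (-Real.log g)) := by
    refine ((h.log hg.ne').neg).congr fun n => ?_
    rw [Real.log_pow]; ring
  have hlog0 : Tendsto (fun n : ℕ => Real.log (p n)) atTop (𝓝 0) := by
    have h1 := (hlog.neg).mul (tendsto_inv_atTop_nhds_zero_nat (𝕜 := ℝ))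
    rw [mul_zero] at h1
    refine h1.congr' ?_
    filter_upwards [eventually_ge_atTop 1] with n hn
    have : (n : ℝ) ≠ 0 := by positivity
    field_simp
  have hp : Tendsto p atTop (𝓝 1) := by
    have h1 := (Real.continuous_exp.tendsto 0).comp hlog0
    rw [Real.exp_zero] at h1
    refine h1.congr' ?_
    filter_upwards [hpos] with n hn
    exact Real.exp_log hn
  have hlow := hp.mul hlog
  rw [one_mul] at hlow
  -- The inequalities `-p log p ≤ 1 - p ≤ -log p` squeeze the sequence.
  refine tendsto_of_tendsto_of_tendsto_of_le_of_le' hlow hlog ?_ ?_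
  · filter_upwards [hpos] with n hn
    have h1 := Real.one_sub_inv_le_log_of_pos hn
    have h2 : p n * -Real.log (p n) ≤ 1 - p n := by
      have h3 := mul_le_mul_of_nonneg_left h1 hn.le
      rw [mul_sub, mul_inv_cancel₀ hn.ne'] at h3
      linarith
    have h4 := mul_le_mul_of_nonneg_left h2 (Nat.cast_nonneg (α := ℝ) n)
    linarith
  · filter_upwards [hpos] with n hn
    have h1 := Real.log_le_sub_one_of_pos hn
    exact mul_le_mul_of_nonneg_left (by linarith) (Nat.cast_nonneg _)

/-- The sequences `a n > 0` and `b n` normalize the partial maxima of `μ` to the limit `G`, jointly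
for all sub-vectors. -/
structure IsNormalizing (μ G : Measure (Fin d → ℝ)) (a b : ℕ → Fin d → ℝ) : Prop where
  pos : ∀ n i, 0 < a n i
  tendsto_pow : ∀ (A : Finset (Fin d)) (x : Fin d → ℝ),
    Tendsto (fun n : ℕ => blockDf μ A (fun i => a n i * x i + b n i) ^ n) atTop
      (𝓝 (blockDf G A x))

lemma InDomainOfAttraction.exists_isNormalizing {μ G : Measure (Fin d → ℝ)}
    [IsProbabilityMeasure μ] [IsProbabilityMeasure G] (h : InDomainOfAttraction μ G) :
    ∃ a b, IsNormalizing μ G a b := by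
  obtain ⟨a, b, ha, hab⟩ := h
  exact ⟨a, b, ha, tendsto_blockDf_pow hab⟩

/-- The exponent function `V_A(x) = -log G_A(x)` of the sub-vector of `G` with indices in `A`. -/
noncomputable def exponent (G : Measure (Fin d → ℝ)) (A : Finset (Fin d)) (x : Fin d → ℝ) : ℝ :=
  -Real.log (blockDf G A x)

lemma HasUnitFrechetMargins.blockDf_singleton {G : Measure (Fin d → ℝ)} [IsProbabilityMeasure G]
    (hG : HasUnitFrechetMargins G) {i : Fin d} {x : Fin d → ℝ} (hx : 0 < x i) :
    blockDf G {i} x = Real.exp (-1 / x i) := by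
  rw [← marginDf_eq_blockDf, hG, if_pos hx]

lemma HasUnitFrechetMargins.exponent_singleton {G : Measure (Fin d → ℝ)} [IsProbabilityMeasure G]
    (hG : HasUnitFrechetMargins G) {i : Fin d} {x : Fin d → ℝ} (hx : 0 < x i) :
    exponent G {i} x = 1 / x i := by
  rw [exponent, hG.blockDf_singleton hx, Real.log_exp]
  ring

/-! ### Rescaled tail probabilities -/

lemma one_sub_blockDf (μ : Measure (Fin d → ℝ)) [IsProbabilityMeasure μ] (A : Finset (Fin d))
    (x : Fin d → ℝ) : 1 - blockDf μ A x = μ.real (⋃ i ∈ A, {y | x i < y i}) := by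
  have h := measureReal_compl (μ := μ) (measurableSet_forall_mem_le A x)
  rw [probReal_univ, ← blockDf_eq] at h
  rw [← h]
  congr 1
  ext y
  simp

lemma one_sub_blockDf_singleton (μ : Measure (Fin d → ℝ)) [IsProbabilityMeasure μ] (i : Fin d)
    (x : Fin d → ℝ) : 1 - blockDf μ {i} x = μ.real {y | x i < y i} := by
  simp [one_sub_blockDf]

lemma one_sub_blockDf_le_sum (μ : Measure (Fin d → ℝ)) [IsProbabilityMeasure μ]
    (A : Finset (Fin d)) (x : Fin d → ℝ) :
    1 - blockDf μ A x ≤ ∑ i ∈ A, (1 - blockDf μ {i} x) := by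
  simp only [one_sub_blockDf_singleton]
  rw [one_sub_blockDf]
  exact measureReal_biUnion_finset_le _ _

section Normalizing

variable {μ G : Measure (Fin d → ℝ)} [IsProbabilityMeasure G] {a b : ℕ → Fin d → ℝ}

lemma IsNormalizing.tendsto_mul_tail_singleton (h : IsNormalizing μ G a b)
    (hG : HasUnitFrechetMargins G) {i : Fin d} {x : Fin d → ℝ} (hx : 0 < x i) :
    Tendsto (fun n : ℕ => (n : ℝ) * (1 - blockDf μ {i} fun i => a n i * x i + b n i)) atTop
      (𝓝 (1 / x i)) := by
  rw [← hG.exponent_singleton hx]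
  refine tendsto_mul_one_sub_of_tendsto_pow (fun n => blockDf_nonneg _ _ _) ?_
    (h.tendsto_pow {i} x)
  rw [hG.blockDf_singleton hx]
  exact Real.exp_pos _

variable [IsProbabilityMeasure μ]

/-- An extreme value distribution is at least the product of its margins: the union bound for the
tails of `μ`, raised to the power `n`, becomes this bound in the limit. -/
lemma IsNormalizing.exp_neg_sum_le (h : IsNormalizing μ G a b) (hG : HasUnitFrechetMargins G)
    {A : Finset (Fin d)} {x : Fin d → ℝ} (hx : ∀ i ∈ A, 0 < x i) :
    Real.exp (-∑ i ∈ A, 1 / x i) ≤ blockDf G A x := by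
  set s : ℕ → ℝ := fun n => ∑ i ∈ A, (1 - blockDf μ {i} fun i => a n i * x i + b n i) with hs
  have h1 : Tendsto (fun n : ℕ => (n : ℝ) * s n) atTop (𝓝 (∑ i ∈ A, 1 / x i)) := by
    simp only [hs, Finset.mul_sum]
    exact tendsto_finsetSum _ fun i hi => h.tendsto_mul_tail_singleton hG (hx i hi)
  have h0 : Tendsto s atTop (𝓝 0) := by
    have h2 := h1.mul (tendsto_inv_atTop_nhds_zero_nat (𝕜 := ℝ))
    rw [mul_zero] at h2
    refine h2.congr' ?_
    filter_upwards [eventually_ge_atTop 1] with n hn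
    have : (n : ℝ) ≠ 0 := by positivity
    field_simp
  have h3 : Tendsto (fun n : ℕ => (1 + -s n) ^ n) atTop (𝓝 (Real.exp (-∑ i ∈ A, 1 / x i))) := by
    refine Real.tendsto_one_add_pow_exp_of_tendsto ?_
    refine h1.neg.congr fun n => ?_
    ring
  refine le_of_tendsto_of_tendsto h3 (h.tendsto_pow A x) ?_
  filter_upwards [h0.eventually_lt_const one_pos] with n hn
  refine pow_le_pow_left₀ (by linarith) ?_ n
  have := one_sub_blockDf_le_sum μ A fun i => a n i * x i + b n i
  linarith

lemma IsNormalizing.blockDf_pos (h : IsNormalizing μ G a b) (hG : HasUnitFrechetMargins G)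
    {A : Finset (Fin d)} {x : Fin d → ℝ} (hx : ∀ i ∈ A, 0 < x i) : 0 < blockDf G A x :=
  (Real.exp_pos _).trans_le (h.exp_neg_sum_le hG hx)

lemma IsNormalizing.exponent_le_sum (h : IsNormalizing μ G a b) (hG : HasUnitFrechetMargins G)
    {A : Finset (Fin d)} {x : Fin d → ℝ} (hx : ∀ i ∈ A, 0 < x i) :
    exponent G A x ≤ ∑ i ∈ A, 1 / x i := by
  have h1 := Real.log_le_log (Real.exp_pos _) (h.exp_neg_sum_le hG hx)
  rw [Real.log_exp] at h1
  rw [exponent]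
  linarith

lemma IsNormalizing.exponent_anti (h : IsNormalizing μ G a b) (hG : HasUnitFrechetMargins G)
    {A B : Finset (Fin d)} {x y : Fin d → ℝ} (hBA : B ⊆ A) (hx : ∀ i ∈ A, 0 < x i)
    (hxy : ∀ i ∈ B, x i ≤ y i) : exponent G B y ≤ exponent G A x :=
  neg_le_neg (Real.log_le_log (h.blockDf_pos hG hx) (blockDf_mono G hBA hxy))

lemma IsNormalizing.tendsto_mul_tail (h : IsNormalizing μ G a b) (hG : HasUnitFrechetMargins G)
    {A : Finset (Fin d)} {x : Fin d → ℝ} (hx : ∀ i ∈ A, 0 < x i) :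
    Tendsto (fun n : ℕ => (n : ℝ) * (1 - blockDf μ A fun i => a n i * x i + b n i)) atTop
      (𝓝 (exponent G A x)) :=
  tendsto_mul_one_sub_of_tendsto_pow (fun _ => blockDf_nonneg _ _ _) (h.blockDf_pos hG hx)
    (h.tendsto_pow A x)

end Normalizing

/-! ### Homogeneity of the exponent function -/

/-- With unit Fréchet margins, the normalization in the max-stability relation is multiplication
by `n`. -/
lemma IsMEV.blockDf_natCast_mul_pow {G : Measure (Fin d → ℝ)} [IsProbabilityMeasure G]
    (hG : IsMEV G) (hF : HasUnitFrechetMargins G) {n : ℕ} (hn : 1 ≤ n) (A : Finset (Fin d))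
    (x : Fin d → ℝ) : blockDf G A (fun i => n * x i) ^ n = blockDf G A x := by
  obtain ⟨a, b, ha, hab⟩ := hG.maxStable n hn
  have hblock : ∀ (A : Finset (Fin d)) (x : Fin d → ℝ),
      blockDf G A (fun i => a i * x i + b i) ^ n = blockDf G A x := by
    intro A x
    have h1 := tendsto_blockDf_univ G A x (fun k _ => k) fun _ _ => tendsto_natCast_atTop_atTop
    have h2 := (tendsto_blockDf_univ G A (fun i => a i * x i + b i) (fun k i => a i * k + b i)
      fun i _ => tendsto_atTop_add_const_right _ _
        (tendsto_natCast_atTop_atTop.const_mul_atTop (ha i))).pow n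
    refine tendsto_nhds_unique (h2.congr fun k => ?_) h1
    have h3 := hab fun i => if i ∈ A then x i else k
    rw [df_coe_eq_blockDf, df_coe_eq_blockDf] at h3
    rw [← h3]
    congr 2
    ext i
    split_ifs <;> rfl
  have hn0 : (0 : ℝ) < n := by positivity
  have hlin : ∀ (i : Fin d) (t : ℝ), 0 < t → a i * t + b i = n * t := by
    intro i t ht
    have h1 := hblock {i} fun _ => t
    rw [hF.blockDf_singleton (x := fun _ => t) ht,
      ← marginDf_eq_blockDf G i (fun i => a i * t + b i), hF] at h1
    split_ifs at h1 with h0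
    · rw [← Real.exp_nat_mul, Real.exp_eq_exp] at h1
      field_simp at h1
      linarith
    · rw [zero_pow (by omega)] at h1
      exact absurd h1.symm (Real.exp_pos _).ne'
  have ha' : ∀ i, a i = n := fun i => by
    linarith [hlin i 1 one_pos, hlin i 2 two_pos]
  have hb' : ∀ i, b i = 0 := fun i => by
    linarith [hlin i 1 one_pos, hlin i 2 two_pos]
  have h := hblock A x
  simpa [ha', hb'] using h

/-- An antitone function on `(0, ∞)` which is homogeneous of order `-1` with respect to positive
integers is a multiple of `c⁻¹`. -/
lemma eq_div_of_natCast_mul {f : ℝ → ℝ} (hanti : ∀ c c', 0 < c → c ≤ c' → f c' ≤ f c)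
    (hmul : ∀ n : ℕ, 1 ≤ n → ∀ c, 0 < c → n * f (n * c) = f c) {c : ℝ} (hc : 0 < c) :
    f c = f 1 / c := by
  have hrat : ∀ q : ℚ, 0 < (q : ℝ) → f q = f 1 / q := by
    intro q hq
    have hq' : 0 < q := by exact_mod_cast hq
    have hnum : 0 < q.num := Rat.num_pos.2 hq'
    have h1 := hmul q.den q.den_pos q hq
    have h2 := hmul q.num.toNat (by omega) 1 one_pos
    have h3 : ((q.num.toNat : ℕ) : ℝ) = (q.num : ℝ) := by
      exact_mod_cast Int.toNat_of_nonneg hnum.le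
    have h4 : (q : ℝ) = q.num / q.den := Rat.cast_def q
    have hd : (0 : ℝ) < q.den := by exact_mod_cast q.den_pos
    have hnum' : (0 : ℝ) < q.num := by exact_mod_cast hnum
    have h5 : (q.den : ℝ) * q = q.num := by rw [h4]; field_simp
    rw [h5] at h1
    rw [h3, mul_one] at h2
    rw [← h1, ← h2, h4]
    field_simp
  have hcont : ContinuousAt (fun c : ℝ => f 1 / c) c := continuousAt_const.div continuousAt_id hc.ne'
  apply le_antisymm
  · by_contra! hlt
    obtain ⟨l, hl, h1⟩ := exists_Ioc_subset_of_mem_nhds (hcont.eventually_lt_const hlt)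
      ⟨c - 1, by linarith⟩
    obtain ⟨q, hq1, hq2⟩ := exists_rat_btwn (max_lt hl hc)
    have hq0 : 0 < (q : ℝ) := (le_max_right _ _).trans_lt hq1
    have h2 : f 1 / q < f c := h1 ⟨(le_max_left _ _).trans_lt hq1, hq2.le⟩
    rw [← hrat q hq0] at h2
    exact absurd (hanti q c hq0 hq2.le) (not_le.2 h2)
  · by_contra! hlt
    obtain ⟨u, hu, h1⟩ := exists_Ico_subset_of_mem_nhds (hcont.eventually_const_lt hlt)
      ⟨c + 1, by linarith⟩
    obtain ⟨q, hq1, hq2⟩ := exists_rat_btwn hu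
    have h2 : f c < f 1 / q := h1 ⟨hq1.le, hq2⟩
    rw [← hrat q (hc.trans hq1)] at h2
    exact absurd (hanti c q hc hq1.le) (not_le.2 h2)

lemma IsMEV.exponent_natCast_mul {G : Measure (Fin d → ℝ)} [IsProbabilityMeasure G]
    (hG : IsMEV G) (hF : HasUnitFrechetMargins G) {n : ℕ} (hn : 1 ≤ n) (A : Finset (Fin d))
    (x : Fin d → ℝ) : n * exponent G A (fun i => n * x i) = exponent G A x := by
  rw [exponent, exponent, ← hG.blockDf_natCast_mul_pow hF hn A x, Real.log_pow]
  ring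

lemma IsMEV.exponent_const {μ G : Measure (Fin d → ℝ)} [IsProbabilityMeasure μ]
    [IsProbabilityMeasure G] {a b : ℕ → Fin d → ℝ} (hG : IsMEV G) (h : IsNormalizing μ G a b)
    (hF : HasUnitFrechetMargins G) (A : Finset (Fin d)) {c : ℝ} (hc : 0 < c) :
    exponent G A (fun _ => c) = extremalCoeff G A / c := by
  have h1 := eq_div_of_natCast_mul (f := fun c => exponent G A fun _ => c)
    (fun c c' hc hcc' => h.exponent_anti hF subset_rfl (fun _ _ => hc) fun _ _ => hcc')
    (fun n hn c _ => hG.exponent_natCast_mul hF hn A fun _ => c) hc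
  rw [h1, extremalCoeff_eq, exponent]

/-! ### Tail probabilities along the diagonal -/

/-- Levels of an antitone tail function `T` are ordered oppositely to the limits of the rescaled
tails. -/
lemma eventually_lt_of_tendsto_mul_tail {α : Type*} {l : Filter α} {T : ℝ → ℝ} (hT : Antitone T)
    {m u v : α → ℝ} {A B : ℝ} (hm : ∀ k, 0 ≤ m k)
    (hu : Tendsto (fun k => m k * T (u k)) l (𝓝 A))
    (hv : Tendsto (fun k => m k * T (v k)) l (𝓝 B)) (hAB : A < B) : ∀ᶠ k in l, v k < u k := by
  filter_upwards [hu.eventually_lt hv hAB] with k hk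
  by_contra! h
  exact absurd (mul_le_mul_of_nonneg_left (hT h) (hm k)) (not_le.2 hk)

/-- A tail function attracted to the unit Fréchet law never vanishes: the scale `a (2 n)` is
asymptotically `2 a n`, so the levels `a n * 2 + b n` are unbounded. -/
lemma tail_pos_of_tendsto_mul {T : ℝ → ℝ} (hT : Antitone T) {a b : ℕ → ℝ} (ha : ∀ n, 0 < a n)
    (h : ∀ x, 0 < x → Tendsto (fun n : ℕ => (n : ℝ) * T (a n * x + b n)) atTop (𝓝 (1 / x)))
    (t : ℝ) : 0 < T t := by
  have hdouble : Tendsto (fun n : ℕ => 2 * n) atTop atTop :=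
    tendsto_id.const_mul_atTop' two_pos
  have h2 : ∀ x, 0 < x → Tendsto (fun n : ℕ => (n : ℝ) * T (a (2 * n) * x + b (2 * n))) atTop
      (𝓝 (1 / x / 2)) := by
    intro x hx
    refine (((h x hx).comp hdouble).div_const 2).congr fun n => ?_
    simp only [Function.comp, Nat.cast_mul, Nat.cast_ofNat]
    ring
  have hcast : ∀ n : ℕ, (0 : ℝ) ≤ n := fun n => n.cast_nonneg
  have h74 := eventually_lt_of_tendsto_mul_tail hT hcast (h2 1 one_pos) (h (7 / 4) (by norm_num))
    (by norm_num)
  have h94 := eventually_lt_of_tendsto_mul_tail hT hcast (h (9 / 4) (by norm_num)) (h2 1 one_pos)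
    (by norm_num)
  have h154 := eventually_lt_of_tendsto_mul_tail hT hcast (h2 2 two_pos)
    (h (15 / 4) (by norm_num)) (by norm_num)
  have hpos : ∀ᶠ n : ℕ in atTop, 0 < (n : ℝ) * T (a n * 2 + b n) :=
    (h 2 two_pos).eventually_const_lt (by norm_num)
  obtain ⟨N, hN⟩ := eventually_atTop.1 (h74.and (h94.and (h154.and hpos)))
  have hind : ∀ k : ℕ, (3 / 2 : ℝ) ^ k * a N ≤ a (2 ^ k * N) ∧
      a N + b N ≤ a (2 ^ k * N) + b (2 ^ k * N) := by
    intro k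
    induction k with
    | zero => simp
    | succ k ih =>
      obtain ⟨h1, h2, h3, -⟩ := hN (2 ^ k * N) (Nat.le_mul_of_pos_left _ (by positivity))
      have h4 := ha (2 ^ k * N)
      have h5 : 2 ^ (k + 1) * N = 2 * (2 ^ k * N) := by ring
      rw [h5, pow_succ]
      exact ⟨by linarith, by linarith⟩
  have hgrow : Tendsto (fun k : ℕ => (3 / 2 : ℝ) ^ k * a N + (a N + b N)) atTop atTop :=
    tendsto_atTop_add_const_right _ _
      ((tendsto_pow_atTop_atTop_of_one_lt (by norm_num)).atTop_mul_const (ha N))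
  obtain ⟨k, hk⟩ := (hgrow.eventually_ge_atTop t).exists
  obtain ⟨-, -, -, h4⟩ := hN (2 ^ k * N) (Nat.le_mul_of_pos_left _ (by positivity))
  have h5 : t ≤ a (2 ^ k * N) * 2 + b (2 ^ k * N) := by
    have := hind k
    linarith [this.1, this.2]
  exact (pos_of_mul_pos_right h4 (hcast _)).trans_le (hT h5)

lemma blockDf_singleton_eq_const (μ : Measure (Fin d → ℝ)) (i : Fin d) (x : Fin d → ℝ) :
    blockDf μ {i} x = blockDf μ {i} fun _ => x i := by
  simp [blockDf_eq]

section Diagonal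

variable {μ G : Measure (Fin d → ℝ)} [IsProbabilityMeasure μ] [IsProbabilityMeasure G]
  {a b : ℕ → Fin d → ℝ} {T : ℝ → ℝ}

/-- If all margins have the same tail `T`, the exceedance probability of every sub-vector over a
common high level is asymptotically proportional to its extremal coefficient. The level `t` is
compared with the normalizing levels for the sample size `⌊1 / T t⌋`. -/
lemma IsNormalizing.tendsto_floor_mul_tail_diagonal (h : IsNormalizing μ G a b) (hG : IsMEV G)
    (hF : HasUnitFrechetMargins G) (hT : ∀ i t, 1 - blockDf μ {i} (fun _ => t) = T t)
    (i₀ : Fin d) (A : Finset (Fin d)) :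
    Tendsto (fun t => (⌊1 / T t⌋₊ : ℝ) * (1 - blockDf μ A fun _ => t)) atTop
      (𝓝 (extremalCoeff G A)) := by
  have hanti : Antitone T := fun s t hst => by
    rw [← hT i₀, ← hT i₀]
    have := blockDf_mono μ (I := {i₀}) (x := fun _ => s) (y := fun _ => t) subset_rfl
      fun _ _ => hst
    linarith
  have htail : ∀ (i : Fin d) (x : ℝ), 0 < x →
      Tendsto (fun n : ℕ => (n : ℝ) * T (a n i * x + b n i)) atTop (𝓝 (1 / x)) := by
    intro i x hx
    refine (h.tendsto_mul_tail_singleton hF (i := i) (x := fun _ => x) hx).congr fun n => ?_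
    rw [blockDf_singleton_eq_const, hT]
  have hpos : ∀ t, 0 < T t :=
    tail_pos_of_tendsto_mul hanti (fun n => h.pos n i₀) (htail i₀)
  have hT0 : Tendsto T atTop (𝓝 0) := by
    have h1 : Tendsto (marginDf μ i₀) atTop (𝓝 1) := tendsto_cdf_atTop _
    have h2 := h1.const_sub 1
    rw [sub_self] at h2
    refine h2.congr fun t => ?_
    rw [← hT i₀, marginDf_eq_blockDf μ i₀ fun _ => t]
  have hinv : Tendsto (fun t => 1 / T t) atTop atTop := by
    simp only [one_div]
    exact Tendsto.inv_tendsto_nhdsGT_zero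
      (tendsto_nhdsWithin_iff.2 ⟨hT0, Eventually.of_forall hpos⟩)
  have hN : Tendsto (fun t => ⌊1 / T t⌋₊) atTop atTop := tendsto_nat_floor_atTop.comp hinv
  have hone : Tendsto (fun t => (⌊1 / T t⌋₊ : ℝ) * T t) atTop (𝓝 1) := by
    refine (tendsto_nat_floor_div_atTop.comp hinv).congr fun t => ?_
    simp
  have hcast : ∀ t : ℝ, (0 : ℝ) ≤ (⌊1 / T t⌋₊ : ℝ) := fun t => Nat.cast_nonneg _
  have hlim : ∀ c : ℝ, 0 < c → Tendsto (fun t => (⌊1 / T t⌋₊ : ℝ) *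
      (1 - blockDf μ A fun i => a ⌊1 / T t⌋₊ i * c + b ⌊1 / T t⌋₊ i)) atTop
        (𝓝 (extremalCoeff G A / c)) := by
    intro c hc
    rw [← hG.exponent_const h hF A hc]
    exact (h.tendsto_mul_tail hF (x := fun _ => c) fun _ _ => hc).comp hN
  have hcont : ContinuousAt (fun c : ℝ => extremalCoeff G A / c) 1 :=
    continuousAt_const.div continuousAt_id one_ne_zero
  refine tendsto_order.2 ⟨fun l hl => ?_, fun r hr => ?_⟩
  · obtain ⟨c, hc1, hc⟩ := exists_Ico_subset_of_mem_nhds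
      (hcont.eventually_const_lt (by simpa using hl)) ⟨2, one_lt_two⟩
    obtain ⟨c', hc'⟩ := exists_between hc1
    have h0 : 0 < c' := one_pos.trans hc'.1
    have hle : ∀ᶠ t in atTop, ∀ i, t < a ⌊1 / T t⌋₊ i * c' + b ⌊1 / T t⌋₊ i :=
      eventually_all.2 fun i => eventually_lt_of_tendsto_mul_tail hanti hcast
        ((htail i c' h0).comp hN) hone ((div_lt_one h0).2 hc'.1)
    filter_upwards [hle, (hlim c' h0).eventually_const_lt (hc ⟨hc'.1.le, hc'.2⟩)] with t h1 h2
    refine h2.trans_le (mul_le_mul_of_nonneg_left (sub_le_sub_left ?_ 1) (hcast t))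
    exact blockDf_mono μ subset_rfl fun i _ => (h1 i).le
  · obtain ⟨c, hc1, hc⟩ := exists_Ioc_subset_of_mem_nhds
      (hcont.eventually_lt_const (by simpa using hr)) ⟨0, one_pos⟩
    obtain ⟨c', hc'⟩ := exists_between (max_lt hc1 one_pos)
    have h0 : 0 < c' := (le_max_right _ _).trans_lt hc'.1
    have hle : ∀ᶠ t in atTop, ∀ i, a ⌊1 / T t⌋₊ i * c' + b ⌊1 / T t⌋₊ i < t :=
      eventually_all.2 fun i => eventually_lt_of_tendsto_mul_tail hanti hcast hone
        ((htail i c' h0).comp hN) ((one_lt_div h0).2 hc'.2)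
    filter_upwards [hle, (hlim c' h0).eventually_lt_const
      (hc ⟨(le_max_left _ _).trans_lt hc'.1, hc'.2.le⟩)] with t h1 h2
    refine lt_of_le_of_lt (mul_le_mul_of_nonneg_left (sub_le_sub_left ?_ 1) (hcast t)) h2
    exact blockDf_mono μ subset_rfl fun i _ => (h1 i).le

end Diagonal

/-! ### The conditional mean number of exceedances -/

section CondMean

variable {Ω : Type*}

lemma setOf_numExceed_pos (X : Ω → Fin d → ℝ)
    (𝒟 : Finpartition (Finset.univ : Finset (Fin d))) (t : ℝ) :
    {ω | 0 < numExceed X 𝒟 t ω} = {ω | ∀ i ∈ (Finset.univ : Finset (Fin d)), X ω i ≤ t}ᶜ := by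
  ext ω
  have : (0 < numExceed X 𝒟 t ω) ↔ ∃ I ∈ 𝒟.parts, ∃ i ∈ I, t < X ω i := by
    rw [numExceed, Finset.sum_pos_iff]
    refine exists_congr fun I => and_congr_right fun _ => ?_
    split_ifs with h
    · simpa using h
    · simpa using h
  simp only [Set.mem_ofPred_eq, Set.mem_compl_iff, this]
  push Not
  constructor
  · rintro ⟨I, -, i, -, hi⟩
    exact ⟨i, Finset.mem_univ i, hi⟩
  · rintro ⟨i, hi, hlt⟩
    obtain ⟨I, hI, hiI⟩ := 𝒟.exists_mem hi
    exact ⟨I, hI, i, hiI, hlt⟩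

variable [MeasurableSpace Ω]

lemma measurableSet_forall_mem_apply_le {X : Ω → Fin d → ℝ} (hX : Measurable X)
    (I : Finset (Fin d)) (t : ℝ) : MeasurableSet {ω | ∀ i ∈ I, X ω i ≤ t} :=
  hX (measurableSet_forall_mem_le I fun _ => t)

lemma measureReal_compl_forall_mem_le (P : Measure Ω) [IsProbabilityMeasure P]
    {X : Ω → Fin d → ℝ} (hX : Measurable X) (I : Finset (Fin d)) (t : ℝ) :
    P.real {ω | ∀ i ∈ I, X ω i ≤ t}ᶜ = 1 - blockDf (P.map X) I fun _ => t := by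
  rw [measureReal_compl (measurableSet_forall_mem_apply_le hX I t), probReal_univ, blockDf_eq,
    map_measureReal_apply hX (measurableSet_forall_mem_le I _)]
  rfl

/-- The conditional mean of `N_t` is a quotient of exceedance probabilities. If `N_t = 0` almost
surely, the conditional measure is zero and both sides are `0`. -/
lemma condMeanExceed_eq (P : Measure Ω) [IsProbabilityMeasure P] {X : Ω → Fin d → ℝ}
    (hX : Measurable X) (𝒟 : Finpartition (Finset.univ : Finset (Fin d))) (t : ℝ) :
    condMeanExceed P X 𝒟 t = (∑ I ∈ 𝒟.parts, (1 - blockDf (P.map X) I fun _ => t)) /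
      (1 - blockDf (P.map X) Finset.univ fun _ => t) := by
  classical
  have hN : ∀ ω, (numExceed X 𝒟 t ω : ℝ) =
      ∑ I ∈ 𝒟.parts, ({ω | ∀ i ∈ I, X ω i ≤ t}ᶜ).indicator (fun _ => (1 : ℝ)) ω := by
    intro ω
    rw [numExceed, Nat.cast_sum]
    refine Finset.sum_congr rfl fun I _ => ?_
    by_cases h : ∀ i ∈ I, X ω i ≤ t
    · rw [if_pos h, Set.indicator_of_notMem (by simpa using h)]; simp
    · rw [if_neg h, Set.indicator_of_mem (by simpa using h)]; simp
  have hm : ∀ I, MeasurableSet {ω | ∀ i ∈ I, X ω i ≤ t}ᶜ := fun I =>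
    (measurableSet_forall_mem_apply_le hX I t).compl
  have hset : ∫ ω in {ω | 0 < numExceed X 𝒟 t ω}, (numExceed X 𝒟 t ω : ℝ) ∂P =
      ∑ I ∈ 𝒟.parts, (1 - blockDf (P.map X) I fun _ => t) := by
    rw [setIntegral_eq_integral_of_forall_compl_eq_zero fun ω hω => by simpa using hω]
    simp only [hN]
    rw [integral_finsetSum _ fun I _ => (integrable_const 1).indicator (hm I)]
    refine Finset.sum_congr rfl fun I _ => ?_
    rw [integral_indicator_const _ (hm I), measureReal_compl_forall_mem_le P hX]
    simp
  rw [condMeanExceed, ProbabilityTheory.cond, integral_smul_measure, hset, setOf_numExceed_pos,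
    ENNReal.toReal_inv, ← measureReal_def, measureReal_compl_forall_mem_le P hX, smul_eq_mul,
    div_eq_inv_mul]

end CondMean

/-! ### Bounds for extremal coefficients -/

section Coefficients

variable {μ G : Measure (Fin d → ℝ)} [IsProbabilityMeasure μ] [IsProbabilityMeasure G]
  {a b : ℕ → Fin d → ℝ}

lemma extremalCoeff_eq_exponent (G : Measure (Fin d → ℝ)) (A : Finset (Fin d)) :
    extremalCoeff G A = exponent G A fun _ => 1 :=
  extremalCoeff_eq G A

lemma IsNormalizing.one_le_extremalCoeff (h : IsNormalizing μ G a b)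
    (hF : HasUnitFrechetMargins G) {A : Finset (Fin d)} (hA : A.Nonempty) :
    1 ≤ extremalCoeff G A := by
  obtain ⟨i, hi⟩ := hA
  have h1 := h.exponent_anti hF (x := fun _ => 1) (y := fun _ => 1)
    (Finset.singleton_subset_iff.2 hi) (fun _ _ => one_pos) fun _ _ => le_rfl
  rw [hF.exponent_singleton one_pos] at h1
  simpa [extremalCoeff_eq_exponent] using h1

lemma IsNormalizing.extremalCoeff_le_card (h : IsNormalizing μ G a b)
    (hF : HasUnitFrechetMargins G) (A : Finset (Fin d)) : extremalCoeff G A ≤ A.card := by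
  have h1 := h.exponent_le_sum hF (A := A) (x := fun _ => 1) fun _ _ => one_pos
  simpa [extremalCoeff_eq_exponent] using h1

/-! ### Independence in the limit -/

/-- The excess of the expected number of exceedances over the exceedance probability. It is the mean
of `(K - 1)⁺`, with `K` the number of exceedances, hence decreases when components are dropped
or levels are raised. -/
lemma sum_tail_sub_tail_mono (μ : Measure (Fin d → ℝ)) [IsProbabilityMeasure μ]
    {S I : Finset (Fin d)} (hSI : S ⊆ I) {x y : Fin d → ℝ} (hxy : ∀ i ∈ S, x i ≤ y i) :
    ∑ i ∈ S, (1 - blockDf μ {i} y) - (1 - blockDf μ S y) ≤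
      ∑ i ∈ I, (1 - blockDf μ {i} x) - (1 - blockDf μ I x) := by
  have hm : ∀ (i : Fin d) (c : ℝ), MeasurableSet {z : Fin d → ℝ | c < z i} := fun i c =>
    measurableSet_lt measurable_const (measurable_pi_apply i)
  simp only [one_sub_blockDf_singleton]
  rw [one_sub_blockDf, one_sub_blockDf, ← Finset.sum_sdiff hSI]
  have hcover : (⋃ i ∈ I, {z : Fin d → ℝ | x i < z i}) ⊆ (⋃ i ∈ S, {z | y i < z i}) ∪
      ((⋃ i ∈ S, {z | x i < z i} \ {z | y i < z i}) ∪ ⋃ i ∈ I \ S, {z | x i < z i}) := by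
    intro z hz
    simp only [Set.mem_iUnion, Set.mem_union, Set.mem_sdiff, Set.mem_ofPred_eq, Finset.mem_sdiff,
      exists_prop] at hz ⊢
    obtain ⟨i, hi, hlt⟩ := hz
    by_cases hS : i ∈ S
    · by_cases hy : y i < z i
      · exact Or.inl ⟨i, hS, hy⟩
      · exact Or.inr (Or.inl ⟨i, hS, hlt, hy⟩)
    · exact Or.inr (Or.inr ⟨i, ⟨hi, hS⟩, hlt⟩)
  have h1 := measureReal_mono (μ := μ) hcover
  have h2 := measureReal_union_le (μ := μ) (⋃ i ∈ S, {z | y i < z i})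
    ((⋃ i ∈ S, {z | x i < z i} \ {z | y i < z i}) ∪ ⋃ i ∈ I \ S, {z | x i < z i})
  have h3 := measureReal_union_le (μ := μ) (⋃ i ∈ S, {z | x i < z i} \ {z | y i < z i})
    (⋃ i ∈ I \ S, {z | x i < z i})
  have h4 := measureReal_biUnion_finset_le (μ := μ) S
    fun i => {z : Fin d → ℝ | x i < z i} \ {z | y i < z i}
  have h5 := measureReal_biUnion_finset_le (μ := μ) (I \ S) fun i => {z : Fin d → ℝ | x i < z i}
  have h6 : ∑ i ∈ S, μ.real ({z : Fin d → ℝ | x i < z i} \ {z | y i < z i}) =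
      ∑ i ∈ S, μ.real {z : Fin d → ℝ | x i < z i} - ∑ i ∈ S, μ.real {z : Fin d → ℝ | y i < z i} := by
    rw [← Finset.sum_sub_distrib]
    refine Finset.sum_congr rfl fun i hi => ?_
    exact measureReal_sdiff (fun z hz => (hxy i hi).trans_lt hz) (hm i _)
  linarith

lemma IsNormalizing.sum_sub_exponent_mono (h : IsNormalizing μ G a b)
    (hF : HasUnitFrechetMargins G) {S I : Finset (Fin d)} (hSI : S ⊆ I) {x y : Fin d → ℝ}
    (hx : ∀ i ∈ I, 0 < x i) (hxy : ∀ i ∈ S, x i ≤ y i) :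
    ∑ i ∈ S, 1 / y i - exponent G S y ≤ ∑ i ∈ I, 1 / x i - exponent G I x := by
  have hlim : ∀ (J : Finset (Fin d)) (z : Fin d → ℝ), (∀ i ∈ J, 0 < z i) →
      Tendsto (fun n : ℕ => (n : ℝ) *
        (∑ i ∈ J, (1 - blockDf μ {i} fun i => a n i * z i + b n i) -
          (1 - blockDf μ J fun i => a n i * z i + b n i))) atTop
        (𝓝 (∑ i ∈ J, 1 / z i - exponent G J z)) := by
    intro J z hz
    simp only [mul_sub (_ : ℝ) (∑ i ∈ J, _), Finset.mul_sum]
    exact (tendsto_finsetSum _ fun i hi => h.tendsto_mul_tail_singleton hF (hz i hi)).sub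
      (h.tendsto_mul_tail hF hz)
  refine le_of_tendsto_of_tendsto' (hlim S y fun i hi => (hx i (hSI hi)).trans_le (hxy i hi))
    (hlim I x hx) fun n => mul_le_mul_of_nonneg_left ?_ n.cast_nonneg
  refine sum_tail_sub_tail_mono μ hSI fun i hi => ?_
  have := mul_le_mul_of_nonneg_left (hxy i hi) (h.pos n i).le
  linarith

/-- If the extremal coefficient of `I` is maximal, the exponent function of every smaller
sub-vector is that of independent components: beyond the point `(1, …, 1)` by monotonicity, and
elsewhere by homogeneity. -/
lemma IsNormalizing.exponent_eq_sum (h : IsNormalizing μ G a b) (hG : IsMEV G)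
    (hF : HasUnitFrechetMargins G) {S I : Finset (Fin d)} (hSI : S ⊆ I)
    (hI : extremalCoeff G I = I.card) {y : Fin d → ℝ} (hy : ∀ i ∈ S, 0 < y i) :
    exponent G S y = ∑ i ∈ S, 1 / y i := by
  refine le_antisymm (h.exponent_le_sum hF hy) ?_
  obtain ⟨n, hn1, hn⟩ : ∃ n : ℕ, 1 ≤ n ∧ ∀ i, i ∈ S → 1 ≤ n * y i := by
    have h1 : ∀ᶠ n : ℕ in atTop, ∀ i, i ∈ S → 1 ≤ n * y i := by
      refine eventually_all.2 fun i => ?_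
      by_cases hi : i ∈ S
      · filter_upwards [(tendsto_natCast_atTop_atTop.atTop_mul_const (hy i hi)).eventually_ge_atTop
          (1 : ℝ)] with n hn _ using hn
      · simp [hi]
    exact ((eventually_ge_atTop 1).and h1).exists
  have h1 := h.sum_sub_exponent_mono hF hSI (x := fun _ => 1) (fun _ _ => one_pos) hn
  rw [← extremalCoeff_eq_exponent, hI] at h1
  rw [← hG.exponent_natCast_mul hF hn1]
  have hn0 : (0 : ℝ) < n := by positivity
  have h2 : ∑ i ∈ S, 1 / y i = n * ∑ i ∈ S, 1 / (n * y i) := by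
    rw [Finset.mul_sum]
    refine Finset.sum_congr rfl fun i hi => ?_
    have := hy i hi
    field_simp
  rw [h2]
  refine mul_le_mul_of_nonneg_left ?_ hn0.le
  simpa using h1

lemma IsNormalizing.blockDf_eq_prod (h : IsNormalizing μ G a b) (hG : IsMEV G)
    (hF : HasUnitFrechetMargins G) {S I : Finset (Fin d)} (hSI : S ⊆ I)
    (hI : extremalCoeff G I = I.card) (y : Fin d → ℝ) :
    blockDf G S y = ∏ i ∈ S, blockDf G {i} y := by
  by_cases hy : ∀ i ∈ S, 0 < y i
  · have h1 := h.exponent_eq_sum hG hF hSI hI hy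
    rw [exponent, neg_eq_iff_eq_neg, ← Finset.sum_neg_distrib] at h1
    rw [← Real.exp_log (h.blockDf_pos hF hy), h1, Real.exp_sum]
    refine Finset.prod_congr rfl fun i hi => ?_
    rw [hF.blockDf_singleton (hy i hi)]
    ring_nf
  · push Not at hy
    obtain ⟨i, hi, hyi⟩ := hy
    have h0 : blockDf G {i} y = 0 := by
      rw [← marginDf_eq_blockDf, hF, if_neg (not_lt.2 hyi)]
    rw [Finset.prod_eq_zero hi h0]
    refine le_antisymm ?_ (blockDf_nonneg _ _ _)
    rw [← h0]
    exact blockDf_mono G (Finset.singleton_subset_iff.2 hi) fun _ _ => le_rfl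

lemma blockDf_eq_prod_of_iIndepFun (μ : Measure (Fin d → ℝ)) {I : Finset (Fin d)}
    (h : iIndepFun (fun (i : I) (y : Fin d → ℝ) => y i) μ) (x : Fin d → ℝ) :
    blockDf μ I x = ∏ i ∈ I, blockDf μ {i} x := by
  have h1 := h.measure_inter_preimage_eq_mul Finset.univ (sets := fun i => Set.Iic (x i))
    fun _ _ => measurableSet_Iic
  have h2 : (⋂ i ∈ (Finset.univ : Finset I), (fun y : Fin d → ℝ => y i) ⁻¹' Set.Iic (x i)) =
      {y | ∀ i ∈ I, y i ≤ x i} := by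
    ext y; simp
  rw [h2] at h1
  rw [blockDf_eq, measureReal_def, h1, ENNReal.toReal_prod, ← Finset.prod_coe_sort I]
  refine Finset.prod_congr rfl fun i _ => ?_
  rw [blockDf_eq, measureReal_def]
  congr 2
  ext y; simp

/-- Coordinates are independent as soon as all distribution functions of sub-vectors factorize. -/
lemma iIndepFun_of_blockDf_eq_prod (μ : Measure (Fin d → ℝ)) [IsProbabilityMeasure μ]
    {I : Finset (Fin d)}
    (h : ∀ S ⊆ I, ∀ y, blockDf μ S y = ∏ i ∈ S, blockDf μ {i} y) :
    iIndepFun (fun (i : I) (y : Fin d → ℝ) => y i) μ := by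
  refine iIndepSets.iIndep (fun i => (measurable_pi_apply (i : Fin d)).comap_le)
    (fun i => Set.preimage (fun y : Fin d → ℝ => y i) '' Set.range Set.Iic)
    (fun i => isPiSystem_Iic.comap _) (fun i => ?_) ?_
  · rw [← MeasurableSpace.comap_generateFrom, ← borel_eq_generateFrom_Iic,
      BorelSpace.measurable_eq (α := ℝ)]
  · rw [iIndepSets_iff]
    intro s f hf
    have hc : ∀ i : I, ∃ c : ℝ, i ∈ s → f i = {y | y i ≤ c} := by
      intro i
      by_cases hi : i ∈ s
      · obtain ⟨-, ⟨c, rfl⟩, hc⟩ := hf i hi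
        exact ⟨c, fun _ => hc.symm⟩
      · exact ⟨0, fun h => absurd h hi⟩
    choose c hc using hc
    set y : Fin d → ℝ := fun i => if hi : i ∈ I then c ⟨i, hi⟩ else 0 with hy
    have hyc : ∀ i : I, y i = c i := fun i => by simp [hy]
    have h1 := h (s.map (Function.Embedding.subtype _)) (fun i hi => by
      obtain ⟨j, -, rfl⟩ := Finset.mem_map.1 hi; exact j.2) y
    rw [Finset.prod_map] at h1
    have h2 : (⋂ i ∈ s, f i) = {z | ∀ i ∈ s.map (Function.Embedding.subtype _), z i ≤ y i} := by
      ext z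
      simp only [Set.mem_iInter, Set.mem_ofPred_eq, Finset.forall_mem_map]
      refine forall₂_congr fun i hi => ?_
      rw [hc i hi]
      simp [hyc]
    have h3 : ∀ i ∈ s, μ.real (f i) = blockDf μ {(i : Fin d)} y := by
      intro i hi
      rw [hc i hi, blockDf_eq]
      simp [hyc]
    rw [← ENNReal.toReal_eq_toReal_iff' (measure_ne_top _ _)
      (ENNReal.prod_ne_top fun i _ => measure_ne_top _ _), ENNReal.toReal_prod]
    change μ.real _ = ∏ i ∈ s, μ.real (f i)
    rw [Finset.prod_congr rfl h3, h2, ← blockDf_eq, h1]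
    rfl

lemma HasUnitFrechetMargins.extremalCoeff_eq_card (hF : HasUnitFrechetMargins G)
    {I : Finset (Fin d)} (h : (blockDf G I fun _ => 1) = ∏ i ∈ I, blockDf G {i} fun _ => 1) :
    extremalCoeff G I = I.card := by
  have h1 : ∀ i ∈ I, (blockDf G {i} fun _ => 1) = Real.exp (-1) := fun i _ => by
    rw [hF.blockDf_singleton one_pos, div_one]
  rw [extremalCoeff_eq, h, Finset.prod_congr rfl h1, Finset.prod_const, Real.log_pow, Real.log_exp]
  ring

lemma IsNormalizing.extremalCoeff_eq_card_iff (h : IsNormalizing μ G a b) (hG : IsMEV G)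
    (hF : HasUnitFrechetMargins G) {I : Finset (Fin d)} :
    extremalCoeff G I = I.card ↔ iIndepFun (fun (i : I) (y : Fin d → ℝ) => y i) G :=
  ⟨fun hI => iIndepFun_of_blockDf_eq_prod G fun _ hS y => h.blockDf_eq_prod hG hF hS hI y,
    fun hI => hF.extremalCoeff_eq_card (blockDf_eq_prod_of_iIndepFun G hI _)⟩

omit [IsProbabilityMeasure μ] in
lemma IsNormalizing.extremalCoeff_eq_card_of_iIndepFun (h : IsNormalizing μ G a b)
    (hF : HasUnitFrechetMargins G) {I : Finset (Fin d)}
    (hI : iIndepFun (fun (i : I) (y : Fin d → ℝ) => y i) μ) : extremalCoeff G I = I.card := by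
  refine hF.extremalCoeff_eq_card (tendsto_nhds_unique (h.tendsto_pow I _) ?_)
  simp only [blockDf_eq_prod_of_iIndepFun μ hI, ← Finset.prod_pow]
  exact tendsto_finsetProd _ fun i _ => h.tendsto_pow {i} _

/-! ### Total dependence in the limit -/

omit [IsProbabilityMeasure G] in
lemma extremalCoeff_eq_one_of_blockDf_eq {I : Finset (Fin d)}
    (h : (blockDf G I fun _ => 1) = Real.exp (-1)) : extremalCoeff G I = 1 := by
  rw [extremalCoeff_eq, h, Real.log_exp, neg_neg]

lemma IsNormalizing.extremalCoeff_eq_one_iff (h : IsNormalizing μ G a b) (hG : IsMEV G)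
    (hF : HasUnitFrechetMargins G) {I : Finset (Fin d)} (hI : I.Nonempty) :
    extremalCoeff G I = 1 ↔ ∀ x : Fin d → ℝ, blockDf G I x = ⨅ i : I, marginDf G i (x i) := by
  have : Nonempty I := hI.to_subtype
  constructor
  · intro h1 x
    refine le_antisymm (le_ciInf fun i => ?_) ?_
    · rw [marginDf_eq_blockDf]
      exact blockDf_mono G (Finset.singleton_subset_iff.2 i.2) fun _ _ => le_rfl
    · obtain ⟨j, hj, hmin⟩ := I.exists_min_image x hI
      refine (ciInf_le (Set.finite_range _).bddBelow ⟨j, hj⟩).trans ?_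
      rw [hF]
      split_ifs with hx
      · refine le_trans (le_of_eq ?_) (blockDf_mono G (x := fun _ => x j) subset_rfl hmin)
        have h2 := hG.exponent_const h hF I hx
        rw [h1, exponent, neg_eq_iff_eq_neg] at h2
        rw [← Real.exp_log (h.blockDf_pos hF (x := fun _ => x j) fun _ _ => hx), h2, neg_div]
      · exact blockDf_nonneg _ _ _
  · intro h1
    refine extremalCoeff_eq_one_of_blockDf_eq ?_
    rw [h1, iInf_congr fun i : I => hF i 1]
    simp

lemma IsNormalizing.extremalCoeff_eq_one_of_totallyDependent (h : IsNormalizing μ G a b)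
    (hF : HasUnitFrechetMargins G) {I : Finset (Fin d)} (hI : I.Nonempty)
    (hdep : ∀ x : Fin d → ℝ, blockDf μ I x = ⨅ i : I, marginDf μ i (x i)) :
    extremalCoeff G I = 1 := by
  have : Nonempty I := hI.to_subtype
  refine extremalCoeff_eq_one_of_blockDf_eq (tendsto_nhds_unique (h.tendsto_pow I _) ?_)
  set p : Finset (Fin d) → ℕ → ℝ := fun A n => blockDf μ A (fun i => a n i * 1 + b n i) ^ n with hp
  have hlim : ∀ i, Tendsto (p {i}) atTop (𝓝 (Real.exp (-1))) := fun i => by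
    have h1 := h.tendsto_pow {i} fun _ => 1
    rwa [hF.blockDf_singleton one_pos, div_one] at h1
  rw [tendsto_iff_norm_sub_tendsto_zero]
  have hsum : Tendsto (fun n => ∑ i : I, ‖p {(i : Fin d)} n - Real.exp (-1)‖) atTop (𝓝 0) := by
    simpa using tendsto_finsetSum (Finset.univ : Finset I) fun i _ =>
      tendsto_iff_norm_sub_tendsto_zero.1 (hlim i)
  -- The distribution function of the block is one of its margins, depending on `n`.
  refine squeeze_zero (fun _ => norm_nonneg _) (fun n => ?_) hsum
  obtain ⟨i, hi⟩ := exists_eq_ciInf_of_finite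
    (f := fun i : I => marginDf μ i (a n i * 1 + b n i))
  have h2 : blockDf μ I (fun i => a n i * 1 + b n i) =
      blockDf μ {(i : Fin d)} fun i => a n i * 1 + b n i := by
    rw [hdep, ← hi, marginDf_eq_blockDf μ i fun i => a n i * 1 + b n i]
  rw [h2]
  exact Finset.single_le_sum (f := fun i : I => ‖p {(i : Fin d)} n - Real.exp (-1)‖)
    (fun _ _ => norm_nonneg _) (Finset.mem_univ i)

end Coefficients

/-! ### The fragility index -/

/-- The fragility index relative to a partition is the sum of the extremal coefficients of the
blocks, divided by the extremal coefficient of the whole vector. -/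
lemma IsNormalizing.hasFragilityIndex {Ω : Type*} [MeasurableSpace Ω] {P : Measure Ω}
    [IsProbabilityMeasure P] {X : Ω → Fin d → ℝ} (hX : Measurable X)
    (hident : ∀ i j : Fin d, IdentDistrib (fun ω => X ω i) (fun ω => X ω j) P P)
    {G : Measure (Fin d → ℝ)} [IsProbabilityMeasure G] {a b : ℕ → Fin d → ℝ}
    (h : IsNormalizing (P.map X) G a b) (hG : IsMEV G) (hF : HasUnitFrechetMargins G)
    (𝒟 : Finpartition (Finset.univ : Finset (Fin d))) (i₀ : Fin d) :
    HasFragilityIndex P X 𝒟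
      ((∑ I ∈ 𝒟.parts, extremalCoeff G I) / extremalCoeff G Finset.univ) := by
  have := Measure.isProbabilityMeasure_map (μ := P) hX.aemeasurable
  set T : ℝ → ℝ := fun t => 1 - blockDf (P.map X) {i₀} fun _ => t with hT
  have hmargin : ∀ i t, 1 - blockDf (P.map X) {i} (fun _ => t) = T t := by
    intro i t
    have hm : ∀ i : Fin d, Measurable fun y : Fin d → ℝ => y i := measurable_pi_apply
    rw [hT, ← marginDf_eq_blockDf (P.map X) i fun _ => t]
    dsimp only
    rw [← marginDf_eq_blockDf (P.map X) i₀ fun _ => t, marginDf, marginDf,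
      Measure.map_map (hm i) hX, Measure.map_map (hm i₀) hX]
    exact congrArg (fun ν => 1 - cdf ν t) (hident i i₀).map_eq
  have hlim := h.tendsto_floor_mul_tail_diagonal hG hF hmargin i₀
  have hD : extremalCoeff G Finset.univ ≠ 0 :=
    (one_pos.trans_le (h.one_le_extremalCoeff hF ⟨i₀, Finset.mem_univ _⟩)).ne'
  refine ((tendsto_finsetSum 𝒟.parts fun I _ => hlim I).div (hlim Finset.univ) hD).congr' ?_
  filter_upwards [(hlim Finset.univ).eventually_ne hD] with t ht
  rw [condMeanExceed_eq P hX, Pi.div_apply, ← Finset.mul_sum,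
    mul_div_mul_left _ _ (left_ne_zero_of_mul ht)]

end Fragility

theorem proposition3p3 {d : ℕ} (hd : 1 ≤ d)
    {Ω : Type*} [MeasurableSpace Ω] (P : Measure Ω) [IsProbabilityMeasure P]
    (X : Ω → Fin d → ℝ) (hX : Measurable X)
    (hident : ∀ i j : Fin d, IdentDistrib (fun ω => X ω i) (fun ω => X ω j) P P)
    (hcont : ∀ i : Fin d, Continuous (Fragility.marginDf (P.map X) i))
    (G : Measure (Fin d → ℝ)) [IsProbabilityMeasure G]
    (hMEV : Fragility.IsMEV G) (hFrechet : Fragility.HasUnitFrechetMargins G)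
    (hDA : Fragility.InDomainOfAttraction (P.map X) G)
    (𝒟 : Finpartition (Finset.univ : Finset (Fin d))) :
    0 < Fragility.extremalCoeff G Finset.univ ∧
    ∃ FI : ℝ, Fragility.HasFragilityIndex P X 𝒟 FI ∧
      ((𝒟.parts.card : ℝ) / Fragility.extremalCoeff G Finset.univ ≤ FI ∧
        FI ≤ (d : ℝ) / Fragility.extremalCoeff G Finset.univ) ∧
      (FI = (d : ℝ) / Fragility.extremalCoeff G Finset.univ ↔
        Fragility.IndepWithinBlocks G 𝒟) ∧
      (FI = (𝒟.parts.card : ℝ) / Fragility.extremalCoeff G Finset.univ ↔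
        Fragility.TotallyDependentWithinBlocks G 𝒟) ∧
      (Fragility.IndepWithinBlocks (P.map X) 𝒟 →
        FI = (d : ℝ) / Fragility.extremalCoeff G Finset.univ) ∧
      (Fragility.TotallyDependentWithinBlocks (P.map X) 𝒟 →
        FI = (𝒟.parts.card : ℝ) / Fragility.extremalCoeff G Finset.univ) := by
  obtain ⟨a, b, h⟩ : ∃ a b, Fragility.IsNormalizing (P.map X) G a b := by
    have := Measure.isProbabilityMeasure_map (μ := P) hX.aemeasurable
    exact hDA.exists_isNormalizing
  have := Measure.isProbabilityMeasure_map (μ := P) hX.aemeasurable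
  have hne : (Finset.univ : Finset (Fin d)).Nonempty := ⟨⟨0, hd⟩, Finset.mem_univ _⟩
  have hpos : 0 < Fragility.extremalCoeff G Finset.univ :=
    one_pos.trans_le (h.one_le_extremalCoeff hFrechet hne)
  have hone : ∀ I ∈ 𝒟.parts, 1 ≤ Fragility.extremalCoeff G I := fun I hI =>
    h.one_le_extremalCoeff hFrechet (𝒟.nonempty_of_mem_parts hI)
  have hcard : ∀ I ∈ 𝒟.parts, Fragility.extremalCoeff G I ≤ (I.card : ℝ) := fun I _ =>
    h.extremalCoeff_le_card hFrechet I
  have hsum1 : ∑ _I ∈ 𝒟.parts, (1 : ℝ) = 𝒟.parts.card := by simp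
  have hsumd : ∑ I ∈ 𝒟.parts, (I.card : ℝ) = d := by
    rw [← Nat.cast_sum, 𝒟.sum_card_parts, Finset.card_univ, Fintype.card_fin]
  have hd_iff : (∑ I ∈ 𝒟.parts, Fragility.extremalCoeff G I) /
      Fragility.extremalCoeff G Finset.univ = (d : ℝ) / Fragility.extremalCoeff G Finset.univ ↔
      ∀ I ∈ 𝒟.parts, Fragility.extremalCoeff G I = I.card := by
    rw [div_left_inj' hpos.ne', ← hsumd, Finset.sum_eq_sum_iff_of_le hcard]
  have hs_iff : (∑ I ∈ 𝒟.parts, Fragility.extremalCoeff G I) /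
      Fragility.extremalCoeff G Finset.univ =
        (𝒟.parts.card : ℝ) / Fragility.extremalCoeff G Finset.univ ↔
      ∀ I ∈ 𝒟.parts, Fragility.extremalCoeff G I = 1 := by
    rw [div_left_inj' hpos.ne', ← hsum1, eq_comm, Finset.sum_eq_sum_iff_of_le hone]
    exact forall₂_congr fun _ _ => eq_comm
  refine ⟨hpos, _, h.hasFragilityIndex hX hident hMEV hFrechet 𝒟 ⟨0, hd⟩, ⟨?_, ?_⟩, ?_, ?_,
    fun hI => ?_, fun hI => ?_⟩
  · rw [← hsum1]
    exact div_le_div_of_nonneg_right (Finset.sum_le_sum hone) hpos.le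
  · rw [← hsumd]
    exact div_le_div_of_nonneg_right (Finset.sum_le_sum hcard) hpos.le
  · rw [hd_iff]
    exact forall₂_congr fun _ _ => h.extremalCoeff_eq_card_iff hMEV hFrechet
  · rw [hs_iff]
    exact forall₂_congr fun I hI =>
      h.extremalCoeff_eq_one_iff hMEV hFrechet (𝒟.nonempty_of_mem_parts hI)
  · exact hd_iff.2 fun I hI' => h.extremalCoeff_eq_card_of_iIndepFun hFrechet (hI I hI')
  · exact hs_iff.2 fun I hI' => h.extremalCoeff_eq_one_of_totallyDependent hFrechet
      (𝒟.nonempty_of_mem_parts hI') (hI I hI')
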